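/- Let $L\ge 3$ and let $m,n\ge 0$ be integers, $q=\max(m,n)$, and let $\mathbf G$ be the $q\times q$ shift matrix over $\mathbb F_2$ ($[\mathbf G]_{ij}=1$ if $i=j+1$, and $0$ otherwise). In one use of the symmetric $L$-transmitter $L$-receiver $(m,n)$ Avestimehr--Diggavi--Tse network, transmitter $\ell$ sends $X_\ell\in\mathbb F_2^q$ and receiver $\ell$ obtains $$Y_\ell=\mathbf G^{\,q-n}X_\ell+\sum_{j\ne\ell}\mathbf G^{\,q-m}X_j,\qquad \ell=1,\dots,L.$$ The sources $S_1^K,\dots,S_L^K\in\mathbb F_2^K$ consist of independent Bernoulli($1/2$) bits. A code of length $N$ for $K$ computations consists of encoders mapping $S_\ell^K$ to $N$ channel inputs $X_\ell^N$, and of decoders by which each receiver $\ell$ estimates the sum $\bigoplus_{j=1}^L S_j^K$ from $Y_\ell^N$; its rate is $K/N$. The computing capacity $C_{\sf comp}$ is the supremum of the $R$ for which there are codes of lengths $N\to\infty$ whose rates tend to $R$ and whose average error probabilities tend to $0$ at every receiver. The linear computing capacity $C^{\sf lin}_{\sf comp}$ is the supremum of the rates $K/N$ ($N\ge1$) of codes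 whose encoders and decoders are all $\mathbb F_2$-linear and for which every receiver always recovers the sum without error. Then $$C^{\sf lin}_{\sf comp}=\begin{cases}\min\{m,\,n,\,\tfrac12\max(m,n)\}, & m\ne n,\\ n, & m=n,\end{cases}$$ and $$C_{\sf comp}\le\begin{cases}\min\{m,\,n,\,\tfrac{L}{2L-1}\max(m,n)\}, & m\ne n,\\ n, & m=n.\end{cases}$$ -/

import Mathlib

open Filter Topology

namespace ADT

/-- The `q × q` shift matrix over `𝔽₂`: the entry `(i, j)` is `1` if `i = j + 1`, else `0`. -/
def shiftMatrix (q : ℕ) : Matrix (Fin q) (Fin q) (ZMod 2) :=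
  Matrix.of fun i j => if (i : ℕ) = (j : ℕ) + 1 then 1 else 0

/-- The `L` signals received in one use of the symmetric `(m, n)` network, with
`q = max m n` levels: receiver `ℓ` gets `G ^ (q - n) X_ℓ + ∑_{j ≠ ℓ} G ^ (q - m) X_j`. -/
def output (L m n : ℕ) (X : Fin L → Fin (max m n) → ZMod 2) (ℓ : Fin L) :
    Fin (max m n) → ZMod 2 :=
  (shiftMatrix (max m n) ^ (max m n - n)).mulVec (X ℓ) +
    ∑ j ∈ Finset.univ.erase ℓ, (shiftMatrix (max m n) ^ (max m n - m)).mulVec (X j)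

/-- A code for computing `K` mod-2 sums with `N` uses of the `(m, n)` network: every transmitter
maps its `K` source bits to `N` channel inputs, and every receiver maps its `N` channel outputs
to an estimate of the `K` sums. -/
structure Code (L m n K N : ℕ) where
  enc : Fin L → (Fin K → ZMod 2) → (Fin N → Fin (max m n) → ZMod 2)
  dec : Fin L → (Fin N → Fin (max m n) → ZMod 2) → (Fin K → ZMod 2)

namespace Code

variable {L m n K N : ℕ}

/-- The estimate of receiver `ℓ` when the sources are `s`. -/
def estimate (c : Code L m n K N) (s : Fin L → Fin K → ZMod 2) (ℓ : Fin L) : Fin K → ZMod 2 :=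
  c.dec ℓ fun t => output L m n (fun j => c.enc j (s j) t) ℓ

/-- The average error probability of receiver `ℓ`. The `L * K` source bits are independent
Bernoulli(1/2), so that the family of all source bits is uniformly distributed. -/
noncomputable def errorProb (c : Code L m n K N) (ℓ : Fin L) : ℝ :=
  ((Finset.univ.filter fun s : Fin L → Fin K → ZMod 2 => c.estimate s ℓ ≠ ∑ j, s j).card : ℝ) /
    (Fintype.card (Fin L → Fin K → ZMod 2) : ℝ)

/-- All encoders and decoders are linear over `𝔽₂`. -/
def IsLinear (c : Code L m n K N) : Prop :=
  (∀ ℓ, IsLinearMap (ZMod 2) (c.enc ℓ)) ∧ ∀ ℓ, IsLinearMap (ZMod 2) (c.dec ℓ)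

/-- Every receiver recovers the sum of the sources, whatever the sources are. -/
def IsZeroError (c : Code L m n K N) : Prop :=
  ∀ (s : Fin L → Fin K → ZMod 2) (ℓ : Fin L), c.estimate s ℓ = ∑ j, s j

end Code

/-- `R` is an achievable computing rate: there are codes of all lengths `N` whose rates `K N / N`
tend to `R` and whose error probabilities tend to `0` at every receiver. -/
def IsAchievable (L m n : ℕ) (R : ℝ) : Prop :=
  ∃ (K : ℕ → ℕ) (c : ∀ N, Code L m n (K N) N),
    Tendsto (fun N : ℕ => (K N : ℝ) / N) atTop (𝓝 R) ∧
      ∀ ℓ : Fin L, Tendsto (fun N => (c N).errorProb ℓ) atTop (𝓝 0)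

/-- `R` is the rate `K / N` of some zero-error linear code. -/
def IsLinearlyAchievable (L m n : ℕ) (R : ℝ) : Prop :=
  ∃ (K N : ℕ) (c : Code L m n K N),
    0 < N ∧ c.IsLinear ∧ c.IsZeroError ∧ R = (K : ℝ) / N

/-- The computing capacity, the supremum of all achievable rates (in the extended reals, so that
no boundedness is presupposed). -/
noncomputable def computingCapacity (L m n : ℕ) : EReal :=
  sSup ((fun R : ℝ => (R : EReal)) '' {R : ℝ | IsAchievable L m n R})

/-- The linear computing capacity, the supremum of the rates of zero-error linear codes. -/
noncomputable def linearComputingCapacity (L m n : ℕ) : EReal :=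
  sSup ((fun R : ℝ => (R : EReal)) '' {R : ℝ | IsLinearlyAchievable L m n R})

end ADT

namespace ADT

/-! Write D and C for the direct and cross gains. In characteristic two, `Y_ℓ = (D + C) X_ℓ + C ∑
X_j` (`output_eq`), and for `m ≠ n` one gain is the identity and the other a nilpotent shift, so `D
+ C` is injective. The bounds `m` and `n` are cut-set bounds for a single link (`card_correct_le`).

For linear codes, keep three active sources. The kernels of the signals at two receivers meet only
in 0 and both lie in the kernel of the sum, which has dimension `2K`; each has dimension at least
`3K - Nq`, so `2K ≤ Nq` (`two_mul_le_of_isLinear_of_isZeroError`). Conversely, a common linear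
encoder aligns the interference: receiver `ℓ` sees D of its own codeword plus C of the codeword of
the sum of the other sources. Placing symbols so that a codeword and its shift can be separated
reaches the minimum.

For arbitrary codes, all outputs together determine every `D X_ℓ`
(`directGain_mulVec_eq_of_output_eq`), hence typically all sources, while each output lies in the
decoding fibre of the common sum, typically of size about `2 ^ (Nq - K)`. Thus `KL ≤ K + L(Nq - K)`
up to a constant (`two_mul_mul_le_of_errorCount`), a counting form of the entropy bound. -/

theorem add_self_zmod_two {ι : Type*} (x : ι → ZMod 2) : x + x = 0 := by
  funext i
  exact CharTwo.add_self_eq_zero (x i)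

theorem eq_of_add_eq_zero_zmod_two {ι : Type*} {x y : ι → ZMod 2} (h : x + y = 0) : x = y := by
  funext i
  exact CharTwo.add_eq_zero.1 (congrFun h i)

/-! ### Powers of the shift and the two gains -/

theorem shiftMatrix_mulVec_apply {q : ℕ} (x : Fin q → ZMod 2) (i : Fin q) :
    (shiftMatrix q).mulVec x i = if h : 1 ≤ (i : ℕ) then x ⟨i - 1, by omega⟩ else 0 := by
  simp only [Matrix.mulVec, dotProduct, shiftMatrix, Matrix.of_apply, ite_mul, one_mul, zero_mul]
  split_ifs with h
  · rw [Finset.sum_eq_single (⟨i - 1, by omega⟩ : Fin q)]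
    · rw [if_pos (by simp only; omega)]
    · intro b _ hb
      rw [if_neg]
      intro h'
      exact hb (Fin.ext (by simp only; omega))
    · simp
  · exact Finset.sum_eq_zero fun b _ => if_neg (by omega)

theorem shiftMatrix_pow_mulVec_apply {q : ℕ} (k : ℕ) (x : Fin q → ZMod 2) (i : Fin q) :
    (shiftMatrix q ^ k).mulVec x i = if h : k ≤ (i : ℕ) then x ⟨i - k, by omega⟩ else 0 := by
  induction k generalizing i with
  | zero => simp
  | succ k ih =>
    rw [pow_succ', ← Matrix.mulVec_mulVec, shiftMatrix_mulVec_apply]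
    by_cases h1 : 1 ≤ (i : ℕ)
    · rw [dif_pos h1, ih]
      by_cases h2 : k + 1 ≤ (i : ℕ)
      · rw [dif_pos h2, dif_pos (by simp only; omega)]
        congr 1
        exact Fin.ext (by simp only; omega)
      · rw [dif_neg h2, dif_neg (by simp only; omega)]
    · rw [dif_neg h1, dif_neg (by omega)]

/-- The gain `G ^ (q - n)` of the direct links. -/
def directGain (m n : ℕ) : Matrix (Fin (max m n)) (Fin (max m n)) (ZMod 2) :=
  shiftMatrix (max m n) ^ (max m n - n)

/-- The gain `G ^ (q - m)` of the cross links. -/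
def crossGain (m n : ℕ) : Matrix (Fin (max m n)) (Fin (max m n)) (ZMod 2) :=
  shiftMatrix (max m n) ^ (max m n - m)

/-- The matrix is unipotent: level `k` of the equation expresses `x k` through `x (k - d)`, or says
that it vanishes. -/
theorem shiftMatrix_pow_add_mulVec_eq_zero {q d : ℕ} (hd : 0 < d) {x : Fin q → ZMod 2}
    (h : x + (shiftMatrix q ^ d).mulVec x = 0) : x = 0 := by
  have key : ∀ (k : ℕ) (hk : k < q), x ⟨k, hk⟩ = 0 := by
    intro k
    induction k using Nat.strong_induction_on with
    | _ k ih =>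
      intro hk
      have h1 := congrFun h ⟨k, hk⟩
      rw [Pi.add_apply, shiftMatrix_pow_mulVec_apply] at h1
      by_cases hkd : d ≤ k
      · rw [dif_pos hkd, ih (k - d) (by omega) (by omega)] at h1
        simpa using h1
      · rw [dif_neg hkd] at h1
        simpa using h1
  funext i
  exact key i i.2

theorem eq_zero_of_gain_add_mulVec_eq_zero {m n : ℕ} (hmn : m ≠ n) {x : Fin (max m n) → ZMod 2}
    (h : (directGain m n + crossGain m n).mulVec x = 0) : x = 0 := by
  rw [Matrix.add_mulVec, directGain, crossGain] at h
  rcases lt_or_gt_of_ne hmn with hlt | hlt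
  · have h0 : max m n - n = 0 := by omega
    rw [h0, pow_zero, Matrix.one_mulVec] at h
    exact shiftMatrix_pow_add_mulVec_eq_zero (by omega) h
  · have h0 : max m n - m = 0 := by omega
    rw [h0, pow_zero, Matrix.one_mulVec, add_comm] at h
    exact shiftMatrix_pow_add_mulVec_eq_zero (by omega) h

theorem gain_add_mulVec_injective {m n : ℕ} (hmn : m ≠ n) {x y : Fin (max m n) → ZMod 2}
    (h : (directGain m n + crossGain m n).mulVec x = (directGain m n + crossGain m n).mulVec y) :
    x = y := by
  refine sub_eq_zero.1 (eq_zero_of_gain_add_mulVec_eq_zero hmn ?_)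
  rw [Matrix.mulVec_sub, h, sub_self]

/-! ### What the outputs determine -/

variable {L m n K N : ℕ}

/-- Adding `C X_ℓ` twice makes the interference term the same at all receivers. -/
theorem output_eq (X : Fin L → Fin (max m n) → ZMod 2) (ℓ : Fin L) :
    output L m n X ℓ = (directGain m n + crossGain m n).mulVec (X ℓ) +
      (crossGain m n).mulVec (∑ j, X j) := by
  rw [output, ← Finset.add_sum_erase _ _ (Finset.mem_univ ℓ), Matrix.mulVec_add,
    Matrix.add_mulVec, Matrix.mulVec_sum]
  simp only [directGain, crossGain]
  rw [add_assoc, ← add_assoc ((shiftMatrix (max m n) ^ (max m n - m)).mulVec (X ℓ)),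
    add_self_zmod_two, zero_add]

theorem output_add (X X' : Fin L → Fin (max m n) → ZMod 2) (ℓ : Fin L) :
    output L m n (X + X') ℓ = output L m n X ℓ + output L m n X' ℓ := by
  simp only [output_eq, Pi.add_apply, Finset.sum_add_distrib, Matrix.mulVec_add]
  abel

theorem output_smul (r : ZMod 2) (X : Fin L → Fin (max m n) → ZMod 2) (ℓ : Fin L) :
    output L m n (r • X) ℓ = r • output L m n X ℓ := by
  simp only [output_eq, Pi.smul_apply, ← Finset.smul_sum, Matrix.mulVec_smul, smul_add]

/-- All the outputs together determine what each transmitter contributes to its own receiver. -/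
theorem directGain_mulVec_eq_of_output_eq (hmn : m ≠ n) {X X' : Fin L → Fin (max m n) → ZMod 2}
    (h : ∀ ℓ, output L m n X ℓ = output L m n X' ℓ) (ℓ : Fin L) :
    (directGain m n).mulVec (X ℓ) = (directGain m n).mulVec (X' ℓ) := by
  set Z := X + X' with hZ
  have hout : ∀ j, output L m n Z j = 0 := fun j => by
    rw [hZ, output_add, h j, add_self_zmod_two]
  have hE : ∀ j, (directGain m n + crossGain m n).mulVec (Z j) =
      (crossGain m n).mulVec (∑ j, Z j) := fun j =>
    eq_of_add_eq_zero_zmod_two (by rw [← output_eq, hout j])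
  -- The right-hand side of `hE` does not depend on `j`.
  have hconst : ∀ j, Z j = Z ℓ := fun j =>
    gain_add_mulVec_injective hmn ((hE j).trans (hE ℓ).symm)
  have hsum : ∑ j, Z j = L • Z ℓ := by
    rw [Finset.sum_congr rfl fun j _ => hconst j]
    simp
  have hzero : (directGain m n).mulVec (Z ℓ) = 0 := by
    have h1 := hE ℓ
    rw [hsum] at h1
    -- For even `L` the sum vanishes and so does `Z`; for odd `L` it is `Z ℓ`, the cross terms
    -- cancel, and only the direct gain of `Z ℓ` is seen to vanish.
    rcases Nat.even_or_odd L with ⟨r, hr⟩ | ⟨r, hr⟩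
    · rw [hr, add_smul, add_self_zmod_two, Matrix.mulVec_zero] at h1
      rw [eq_zero_of_gain_add_mulVec_eq_zero hmn h1, Matrix.mulVec_zero]
    · rw [hr, two_mul, add_smul, add_smul, add_self_zmod_two, zero_add, one_smul,
        Matrix.add_mulVec] at h1
      simpa using h1
  refine eq_of_add_eq_zero_zmod_two ?_
  rw [← Matrix.mulVec_add]
  exact hzero

/-! ### Cut-set bounds for one link -/

/-- The block of signals at receiver `ℓ` when the sources are `s`. -/
def Code.received (c : Code L m n K N) (s : Fin L → Fin K → ZMod 2) (ℓ : Fin L) :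
    Fin N → Fin (max m n) → ZMod 2 :=
  fun t => output L m n (fun j => c.enc j (s j) t) ℓ

theorem Code.estimate_eq (c : Code L m n K N) (s : Fin L → Fin K → ZMod 2) (ℓ : Fin L) :
    c.estimate s ℓ = c.dec ℓ (c.received s ℓ) := rfl

/-- The number of levels by which transmitter `i` reaches receiver `ℓ`. -/
def linkLevels (m n : ℕ) (i ℓ : Fin L) : ℕ := if i = ℓ then n else m

theorem linkLevels_le (i ℓ : Fin L) : linkLevels m n i ℓ ≤ max m n := by
  unfold linkLevels
  split_ifs <;> omega

theorem received_update_eq (c : Code L m n K N) (i ℓ : Fin L) (s : Fin L → Fin K → ZMod 2)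
    {x y : Fin K → ZMod 2}
    (h : ∀ t, (shiftMatrix (max m n) ^ (max m n - linkLevels m n i ℓ)).mulVec (c.enc i x t) =
      (shiftMatrix (max m n) ^ (max m n - linkLevels m n i ℓ)).mulVec (c.enc i y t)) :
    c.received (Function.update s i x) ℓ = c.received (Function.update s i y) ℓ := by
  funext t
  simp only [Code.received, output]
  by_cases hi : i = ℓ
  · subst hi
    simp only [linkLevels, if_true] at h
    congr 1
    · simpa using h t
    · refine Finset.sum_congr rfl fun j hj => ?_
      have hji : j ≠ i := Finset.ne_of_mem_erase hj
      simp [Function.update_of_ne hji]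
  · simp only [linkLevels, if_neg hi] at h
    congr 1
    · simp [Function.update_of_ne (Ne.symm hi)]
    · refine Finset.sum_congr rfl fun j hj => ?_
      by_cases hji : j = i
      · subst hji
        simpa using h t
      · simp [Function.update_of_ne hji]

/-- The receiver cannot distinguish the two values, so its two correct estimates coincide and the
other sources cancel from the sums. -/
theorem eq_of_correct_of_gain_eq (c : Code L m n K N) (i ℓ : Fin L) (s : Fin L → Fin K → ZMod 2)
    {x y : Fin K → ZMod 2}
    (hx : c.estimate (Function.update s i x) ℓ = ∑ j, Function.update s i x j)
    (hy : c.estimate (Function.update s i y) ℓ = ∑ j, Function.update s i y j)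
    (h : ∀ t, (shiftMatrix (max m n) ^ (max m n - linkLevels m n i ℓ)).mulVec (c.enc i x t) =
      (shiftMatrix (max m n) ^ (max m n - linkLevels m n i ℓ)).mulVec (c.enc i y t)) :
    x = y := by
  rw [Code.estimate_eq, received_update_eq c i ℓ s h, ← Code.estimate_eq, hy] at hx
  simp only [Finset.sum_update_of_mem (Finset.mem_univ i)] at hx
  exact (add_right_cancel hx).symm

theorem mulVec_shift_eq_of_forall_lt {q r : ℕ} (hr : r ≤ q) {x y : Fin q → ZMod 2}
    (h : ∀ i : Fin r, x (Fin.castLE hr i) = y (Fin.castLE hr i)) :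
    (shiftMatrix q ^ (q - r)).mulVec x = (shiftMatrix q ^ (q - r)).mulVec y := by
  funext i
  rw [shiftMatrix_pow_mulVec_apply, shiftMatrix_pow_mulVec_apply]
  split_ifs with hi
  · exact h ⟨i - (q - r), by omega⟩
  · rfl

/-- With the other sources frozen, a correctly decoded value is determined by the top levels of the
codeword that pass the link. -/
theorem card_correct_le (c : Code L m n K N) (i ℓ : Fin L) (s : Fin L → Fin K → ZMod 2) :
    (Finset.univ.filter fun x : Fin K → ZMod 2 =>
      c.estimate (Function.update s i x) ℓ = ∑ j, Function.update s i x j).card ≤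
      2 ^ (N * linkLevels m n i ℓ) := by
  have hr := linkLevels_le (m := m) (n := n) i ℓ
  have hcard : Fintype.card (Fin N → Fin (linkLevels m n i ℓ) → ZMod 2) =
      2 ^ (N * linkLevels m n i ℓ) := by
    simp [ZMod.card, ← pow_mul, mul_comm]
  rw [← hcard, ← Finset.card_univ]
  refine Finset.card_le_card_of_injOn (fun x t k => c.enc i x t (Fin.castLE hr k))
    (fun _ _ => Finset.mem_coe.2 (Finset.mem_univ _)) ?_
  intro x hx y hy hxy
  simp only [Finset.coe_filter, Finset.mem_univ, true_and, Set.mem_ofPred_eq] at hx hy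
  exact eq_of_correct_of_gain_eq c i ℓ s hx hy fun t =>
    mulVec_shift_eq_of_forall_lt hr fun k => congrFun (congrFun hxy t) k

theorem Code.IsZeroError.le_mul_linkLevels {c : Code L m n K N} (hc : c.IsZeroError)
    (i ℓ : Fin L) : K ≤ N * linkLevels m n i ℓ := by
  have h := card_correct_le c i ℓ 0
  rw [Finset.filter_true_of_mem fun x _ => hc _ ℓ, Finset.card_univ] at h
  simp only [Fintype.card_fun, ZMod.card, Fintype.card_fin] at h
  exact (Nat.pow_le_pow_iff_right (by norm_num)).1 h

/-! ### Converse for linear codes -/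

/-- The received block as a linear function of the sources. -/
def Code.receivedLinear (c : Code L m n K N) (hc : c.IsLinear) (ℓ : Fin L) :
    (Fin L → Fin K → ZMod 2) →ₗ[ZMod 2] (Fin N → Fin (max m n) → ZMod 2) where
  toFun s := c.received s ℓ
  map_add' s s' := by
    funext t
    rw [Pi.add_apply, Code.received, Code.received, Code.received, ← output_add]
    congr 1
    funext j
    rw [Pi.add_apply, (hc.1 j).map_add]
    rfl
  map_smul' r s := by
    funext t
    rw [Pi.smul_apply, RingHom.id_apply, Code.received, Code.received, ← output_smul]
    congr 1
    funext j
    rw [Pi.smul_apply, (hc.1 j).map_smul]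
    rfl

theorem sum_eq_zero_of_received_eq_zero {c : Code L m n K N} (hl : c.IsLinear)
    (hz : c.IsZeroError) {s : Fin L → Fin K → ZMod 2} {ℓ : Fin L} (h : c.received s ℓ = 0) :
    ∑ j, s j = 0 := by
  rw [← hz s ℓ, Code.estimate_eq, h, (hl.2 ℓ).map_zero]

/-- The family that is `a`, `b`, `c` at the indices `0`, `1`, `2` and zero elsewhere. -/
def threeUsers (L : ℕ) {A : Type*} [Zero A] (p : A × A × A) : Fin L → A := fun j =>
  if (j : ℕ) = 0 then p.1 else if (j : ℕ) = 1 then p.2.1 else if (j : ℕ) = 2 then p.2.2 else 0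

theorem sum_threeUsers {A B : Type*} [Zero A] [AddCommMonoid B] (hL : 3 ≤ L)
    (f : Fin L → A → B) (hf : ∀ j, f j 0 = 0) (p : A × A × A) :
    ∑ j, f j (threeUsers L p j) =
      f ⟨0, by omega⟩ p.1 + (f ⟨1, by omega⟩ p.2.1 + f ⟨2, by omega⟩ p.2.2) := by
  rw [← Finset.sum_subset (Finset.subset_univ
    ({⟨0, by omega⟩, ⟨1, by omega⟩, ⟨2, by omega⟩} : Finset (Fin L)))]
  · rw [Finset.sum_insert (by simp), Finset.sum_insert (by simp), Finset.sum_singleton]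
    simp [threeUsers]
  · intro j _ hj
    simp only [Finset.mem_insert, Finset.mem_singleton, Fin.ext_iff, not_or] at hj
    simp [threeUsers, hj.1, hj.2.1, hj.2.2, hf]

/-- `threeUsers` as a linear map. -/
def threeUsersLinear (L K : ℕ) :
    ((Fin K → ZMod 2) × (Fin K → ZMod 2) × (Fin K → ZMod 2)) →ₗ[ZMod 2]
      (Fin L → Fin K → ZMod 2) where
  toFun p := threeUsers L p
  map_add' p p' := by
    funext j
    simp only [threeUsers, Pi.add_apply, Prod.fst_add, Prod.snd_add]
    split_ifs <;> simp
  map_smul' r p := by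
    funext j
    simp only [threeUsers, Pi.smul_apply, Prod.smul_fst, Prod.smul_snd, RingHom.id_apply]
    split_ifs <;> simp

theorem received_threeUsers (c : Code L m n K N) (hl : c.IsLinear) (hL : 3 ≤ L)
    (a b d : Fin K → ZMod 2) (ℓ : Fin L) (t : Fin N) :
    c.received (threeUsers L (a, b, d)) ℓ t =
      (directGain m n + crossGain m n).mulVec (c.enc ℓ (threeUsers L (a, b, d) ℓ) t) +
        (crossGain m n).mulVec (c.enc ⟨0, by omega⟩ a t +
          (c.enc ⟨1, by omega⟩ b t + c.enc ⟨2, by omega⟩ d t)) := by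
  rw [Code.received, output_eq, sum_threeUsers hL (fun j x => c.enc j x t)
    (fun j => by simp only [(hl.1 j).map_zero]; rfl)]

/-- Receiver 2 serves as a test: source triples with last entry 0 that are silent there must have
sum zero. -/
theorem eq_zero_of_received_eq_zero {c : Code L m n K N} (hl : c.IsLinear)
    (hz : c.IsZeroError) (hL : 3 ≤ L) (hmn : m ≠ n) {a b d : Fin K → ZMod 2}
    (h0 : c.received (threeUsers L (a, b, d)) ⟨0, by omega⟩ = 0)
    (h1 : c.received (threeUsers L (a, b, d)) ⟨1, by omega⟩ = 0) :
    a = 0 ∧ b = 0 ∧ d = 0 := by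
  have enc_zero : ∀ j t, c.enc j 0 t = 0 := fun j t => by rw [(hl.1 j).map_zero]; rfl
  have sum_eq : ∀ x y z : Fin K → ZMod 2,
      ∑ j, threeUsers L (x, y, z) j = x + (y + z) := fun x y z =>
    sum_threeUsers hL (fun _ x => x) (fun _ => rfl) (x, y, z)
  -- Both receivers see the same interference term, so `D + C` takes equal values at the two inputs.
  have hX : ∀ t, c.enc ⟨0, by omega⟩ a t = c.enc ⟨1, by omega⟩ b t := by
    intro t
    have e0 := congrFun h0 t
    have e1 := congrFun h1 t
    rw [received_threeUsers c hl hL] at e0 e1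
    have h := (eq_of_add_eq_zero_zmod_two e0).trans (eq_of_add_eq_zero_zmod_two e1).symm
    simpa [threeUsers] using gain_add_mulVec_injective hmn h
  have hab : a + b = 0 := by
    have h2 : c.received (threeUsers L (a, b, 0)) ⟨2, by omega⟩ = 0 := by
      funext t
      rw [received_threeUsers c hl hL, enc_zero, add_zero, hX t, add_self_zmod_two]
      simp [threeUsers, enc_zero]
    have h3 := sum_eq_zero_of_received_eq_zero hl hz h2
    rwa [sum_eq, add_zero] at h3
  have hd : d = 0 := by
    have h3 := sum_eq_zero_of_received_eq_zero hl hz h0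
    rwa [sum_eq, ← add_assoc, hab, zero_add] at h3
  have hXa : ∀ t, c.enc ⟨0, by omega⟩ a t = 0 := by
    intro t
    have e0 := congrFun h0 t
    rw [received_threeUsers c hl hL, hd, enc_zero, add_zero, hX t, add_self_zmod_two] at e0
    refine eq_zero_of_gain_add_mulVec_eq_zero hmn ?_
    simpa [threeUsers] using e0
  have ha : a = 0 := by
    have h2 : c.received (threeUsers L (a, 0, 0)) ⟨2, by omega⟩ = 0 := by
      funext t
      rw [received_threeUsers c hl hL, enc_zero, enc_zero, hXa t]
      simp [threeUsers, enc_zero]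
    have h3 := sum_eq_zero_of_received_eq_zero hl hz h2
    rwa [sum_eq, add_zero, add_zero] at h3
  rw [ha, zero_add] at hab
  exact ⟨ha, hab, hd⟩

/-- Two kernels of dimension at least `3K - Nq` are independent inside a space of dimension `2K`, so
`2(3K - Nq) ≤ 2K`. -/
theorem two_mul_le_of_isLinear_of_isZeroError {c : Code L m n K N} (hl : c.IsLinear)
    (hz : c.IsZeroError) (hL : 3 ≤ L) (hmn : m ≠ n) : 2 * K ≤ N * max m n := by
  set Φ := fun ℓ : Fin L => (c.receivedLinear hl ℓ).comp (threeUsersLinear L K) with hΦ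
  set σ : ((Fin K → ZMod 2) × (Fin K → ZMod 2) × (Fin K → ZMod 2)) →ₗ[ZMod 2]
    (Fin K → ZMod 2) := LinearMap.id.coprod (LinearMap.id.coprod LinearMap.id) with hσ
  have hσs : Function.Surjective σ := fun a => ⟨(a, 0, 0), by simp [hσ]⟩
  have hle : ∀ ℓ, LinearMap.ker (Φ ℓ) ≤ LinearMap.ker σ := by
    rintro ℓ ⟨a, b, d⟩ h
    have h3 := sum_eq_zero_of_received_eq_zero hl hz (LinearMap.mem_ker.1 h)
    rw [LinearMap.mem_ker]
    rw [← h3]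
    exact (sum_threeUsers hL (fun _ x => x) (fun _ => rfl) (a, b, d)).symm
  have hinf : LinearMap.ker (Φ ⟨0, by omega⟩) ⊓ LinearMap.ker (Φ ⟨1, by omega⟩) = ⊥ := by
    rw [eq_bot_iff]
    rintro ⟨a, b, d⟩ ⟨h0, h1⟩
    obtain ⟨rfl, rfl, rfl⟩ := eq_zero_of_received_eq_zero hl hz hL hmn
      (LinearMap.mem_ker.1 h0) (LinearMap.mem_ker.1 h1)
    rfl
  have hdom : Module.finrank (ZMod 2)
      ((Fin K → ZMod 2) × (Fin K → ZMod 2) × (Fin K → ZMod 2)) = K + (K + K) := by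
    simp
  have hcod : Module.finrank (ZMod 2) (Fin N → Fin (max m n) → ZMod 2) = N * max m n := by
    simp [Module.finrank_pi_fintype]
  have hK : Module.finrank (ZMod 2) (Fin K → ZMod 2) = K := by simp
  have hker : ∀ ℓ, 3 * K ≤ N * max m n + Module.finrank (ZMod 2) (LinearMap.ker (Φ ℓ)) := by
    intro ℓ
    have h1 := LinearMap.finrank_range_add_finrank_ker (Φ ℓ)
    have h2 := Submodule.finrank_le (LinearMap.range (Φ ℓ))
    rw [hdom] at h1
    rw [hcod] at h2
    omega
  have hkσ : Module.finrank (ZMod 2) (LinearMap.ker σ) = 2 * K := by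
    have h1 := LinearMap.finrank_range_add_finrank_ker σ
    rw [LinearMap.range_eq_top.2 hσs, finrank_top, hdom, hK] at h1
    omega
  have hsup := Submodule.finrank_sup_add_finrank_inf_eq (LinearMap.ker (Φ ⟨0, by omega⟩))
    (LinearMap.ker (Φ ⟨1, by omega⟩))
  rw [hinf, finrank_bot] at hsup
  have hmono := Submodule.finrank_mono (sup_le (hle ⟨0, by omega⟩) (hle ⟨1, by omega⟩))
  have h0 := hker ⟨0, by omega⟩
  have h1 := hker ⟨1, by omega⟩
  omega

/-! ### Linear schemes -/

/-- Supplies linear decoders: `f` is injective modulo its kernel, and over a field a linear left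
inverse extends to all of `W`. -/
theorem exists_linearMap_apply_eq {k U W Z : Type*} [Field k] [AddCommGroup U] [Module k U]
    [AddCommGroup W] [Module k W] [AddCommGroup Z] [Module k Z] (f : U →ₗ[k] W) (g : U →ₗ[k] Z)
    (h : LinearMap.ker f ≤ LinearMap.ker g) : ∃ φ : W →ₗ[k] Z, ∀ u, φ (f u) = g u := by
  have hinj : LinearMap.ker ((LinearMap.ker f).liftQ f le_rfl) = ⊥ :=
    Submodule.ker_liftQ_eq_bot _ _ _ le_rfl
  obtain ⟨r, hr⟩ := LinearMap.exists_leftInverse_of_injective _ hinj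
  refine ⟨((LinearMap.ker f).liftQ g h).comp r, fun u => ?_⟩
  have h1 := LinearMap.congr_fun hr (Submodule.Quotient.mk u)
  rw [LinearMap.comp_apply, Submodule.liftQ_apply] at h1
  rw [LinearMap.comp_apply, h1]
  rfl

/-- A linear encoder, common to all transmitters, from whose direct and cross images the
receivers can tell the sum of the sources. -/
theorem isLinearlyAchievable_of_linear_encoder (hN : 0 < N) (V : (Fin K → ZMod 2) →ₗ[ZMod 2]
      (Fin N → Fin (max m n) → ZMod 2))
    (hV : ∀ a b, (∀ t, (directGain m n).mulVec (V a t) + (crossGain m n).mulVec (V b t) = 0) →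
      a + b = 0) :
    IsLinearlyAchievable L m n ((K : ℝ) / N) := by
  set Ψ : ((Fin K → ZMod 2) × (Fin K → ZMod 2)) →ₗ[ZMod 2] (Fin N → Fin (max m n) → ZMod 2) :=
    LinearMap.coprod (LinearMap.pi fun t =>
        (Matrix.mulVecLin (directGain m n)).comp ((LinearMap.proj t).comp V))
      (LinearMap.pi fun t =>
        (Matrix.mulVecLin (crossGain m n)).comp ((LinearMap.proj t).comp V)) with hΨ
  set σ : ((Fin K → ZMod 2) × (Fin K → ZMod 2)) →ₗ[ZMod 2] (Fin K → ZMod 2) :=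
    LinearMap.id.coprod LinearMap.id with hσ
  have hΨa : ∀ a b t, Ψ (a, b) t =
      (directGain m n).mulVec (V a t) + (crossGain m n).mulVec (V b t) := fun a b t => by
    simp [hΨ]
  obtain ⟨φ, hφ⟩ := exists_linearMap_apply_eq Ψ σ (by
    rintro ⟨a, b⟩ h
    rw [LinearMap.mem_ker] at h ⊢
    have := hV a b fun t => by rw [← hΨa, h]; rfl
    simpa [hσ] using this)
  refine ⟨K, N, ⟨fun _ => V, fun _ => φ⟩, hN, ⟨fun _ => V.isLinear, fun _ => φ.isLinear⟩, ?_, rfl⟩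
  intro s ℓ
  -- Alignment: by linearity of `V`, the interferers act as one transmitter whose source is their
  -- sum.
  have hrec : (fun t => output L m n (fun j => V (s j) t) ℓ) =
      Ψ (s ℓ, ∑ j ∈ Finset.univ.erase ℓ, s j) := by
    funext t
    rw [hΨa, output, map_sum, Finset.sum_apply, Matrix.mulVec_sum]
    rfl
  rw [Code.estimate]
  simp only [hrec, hφ]
  rw [← Finset.add_sum_erase _ _ (Finset.mem_univ ℓ)]
  simp [hσ]

/-- For `m ≠ n` one of the two gains is the identity and the other a power of the shift. -/
theorem isLinearlyAchievable_of_shift_injective (hmn : m ≠ n) (hN : 0 < N)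
    (V : (Fin K → ZMod 2) →ₗ[ZMod 2] (Fin N → Fin (max m n) → ZMod 2))
    (hV : ∀ a b, (∀ t, V a t +
      (shiftMatrix (max m n) ^ (max m n - min m n)).mulVec (V b t) = 0) → a = 0 ∧ b = 0) :
    IsLinearlyAchievable L m n ((K : ℝ) / N) := by
  refine isLinearlyAchievable_of_linear_encoder hN V fun a b h => ?_
  rw [directGain, crossGain] at h
  rcases lt_or_gt_of_ne hmn with hlt | hlt
  · have h0 : max m n - n = 0 := by omega
    have h1 : max m n - m = max m n - min m n := by omega
    simp only [h0, h1, pow_zero, Matrix.one_mulVec] at h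
    obtain ⟨rfl, rfl⟩ := hV a b h
    simp
  · have h0 : max m n - m = 0 := by omega
    have h1 : max m n - n = max m n - min m n := by omega
    simp only [h0, h1, pow_zero, Matrix.one_mulVec] at h
    obtain ⟨rfl, rfl⟩ := hV b a fun t => by rw [add_comm]; exact h t
    simp

theorem isLinearlyAchievable_of_eq (n : ℕ) : IsLinearlyAchievable L n n n := by
  have h := isLinearlyAchievable_of_linear_encoder (L := L) (m := n) (n := n) (K := max n n)
    one_pos (LinearMap.pi fun _ => LinearMap.id) (fun a b h => by
      have h0 : max n n - n = 0 := by omega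
      have := h 0
      simp only [directGain, crossGain, h0, pow_zero, Matrix.one_mulVec] at this
      exact this)
  simpa using h

/-- Extension of a vector by zero to all natural indices. -/
def extendZero (q : ℕ) : (Fin q → ZMod 2) →ₗ[ZMod 2] (ℕ → ZMod 2) where
  toFun s i := if h : i < q then s ⟨i, h⟩ else 0
  map_add' s s' := by
    funext i
    simp only [Pi.add_apply]
    split_ifs <;> simp
  map_smul' r s := by
    funext i
    simp only [Pi.smul_apply, RingHom.id_apply]
    split_ifs <;> simp

theorem extendZero_of_lt {q i : ℕ} (s : Fin q → ZMod 2) (h : i < q) :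
    extendZero q s i = s ⟨i, h⟩ := dif_pos h

theorem extendZero_of_le {q i : ℕ} (s : Fin q → ZMod 2) (h : q ≤ i) :
    extendZero q s i = 0 := dif_neg (by omega)

theorem eq_zero_of_extendZero {q : ℕ} {s : Fin q → ZMod 2}
    (h : ∀ i < q, extendZero q s i = 0) : s = 0 := by
  funext i
  rw [← extendZero_of_lt s i.2, h i i.2]
  rfl

/-- Symbols on the top `min m n` levels are disjoint from their shift by `max m n - min m n`, so one
channel use suffices. -/
theorem isLinearlyAchievable_min (hmn : m ≠ n) (h : 2 * min m n ≤ max m n) :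
    IsLinearlyAchievable L m n ((min m n : ℕ) : ℝ) := by
  have key := isLinearlyAchievable_of_shift_injective (L := L) (K := min m n) (N := 1) hmn one_pos
    (LinearMap.pi fun _ => LinearMap.pi fun i =>
      (LinearMap.proj (i : ℕ)).comp (extendZero (min m n))) (fun a b hab => by
    have h0 := hab 0
    have hi : ∀ i : ℕ, i < max m n → extendZero (min m n) a i +
        (if max m n - min m n ≤ i then
          extendZero (min m n) b (i - (max m n - min m n)) else 0) = 0 := by
      intro i hi
      have h1 := congrFun h0 ⟨i, hi⟩
      rw [Pi.add_apply, shiftMatrix_pow_mulVec_apply] at h1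
      simpa using h1
    constructor
    · refine eq_zero_of_extendZero fun i hi' => ?_
      have h1 := hi i (by omega)
      split_ifs at h1 with h2
      · rw [extendZero_of_le b (by omega), add_zero] at h1
        exact h1
      · simpa using h1
    · refine eq_zero_of_extendZero fun i hi' => ?_
      have h1 := hi (i + (max m n - min m n)) (by omega)
      rw [if_pos (by omega), extendZero_of_le a (by omega), zero_add, Nat.add_sub_cancel] at h1
      exact h1)
  simpa using key

theorem even_add_div_iff {d : ℕ} (hd : 0 < d) (i : ℕ) : Even ((i + d) / d) ↔ ¬ Even (i / d) := by
  rw [Nat.add_div_right _ hd, Nat.even_add_one]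

/-- The level `i` of the first of two channel inputs that carry the symbols `s`. Levels whose index
is in an even block of length `d` carry a symbol of their own, and those in the odd blocks next to
the end repeat the symbol of the following block. -/
def firstInput (q d : ℕ) (s : ℕ → ZMod 2) (i : ℕ) : ZMod 2 :=
  if Even (i / d) then (if i + d < q then s i else 0)
  else (if q ≤ i + d + d then s (i + d) else 0)

/-- The level `i` of the second of two channel inputs that carry the symbols `s`. -/
def secondInput (q d : ℕ) (s : ℕ → ZMod 2) (i : ℕ) : ZMod 2 :=
  if Even (i / d) then (if i + d < q then s (i + d) else s i) else 0

/-- A symbol of `b` must survive the shift, which drops the last `d` levels. Such a symbol in an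
even block is therefore repeated `d` levels earlier in the first input; a symbol in an odd block
travels `d` levels earlier in the second. -/
theorem eq_zero_of_firstInput_of_secondInput {q d : ℕ} (hd : 0 < d) (hq : 2 * d ≤ q)
    {a b : ℕ → ZMod 2} (ha : ∀ i, q ≤ i → a i = 0)
    (h1 : ∀ i < q, firstInput q d a i + (if d ≤ i then firstInput q d b (i - d) else 0) = 0)
    (h2 : ∀ i < q, secondInput q d a i + (if d ≤ i then secondInput q d b (i - d) else 0) = 0) :
    (∀ i, a i = 0) ∧ ∀ i < q, b i = 0 := by
  have heven : ∀ i, ¬ Even (i / d) → ∃ k, i = k + d ∧ Even (k / d) := by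
    intro i hi
    have hdi : d ≤ i := by
      by_contra hlt
      rw [Nat.div_eq_of_lt (by omega)] at hi
      exact hi Even.zero
    refine ⟨i - d, by omega, ?_⟩
    have h := even_add_div_iff hd (i - d)
    rw [Nat.sub_add_cancel hdi] at h
    tauto
  have hodd : ∀ i, Even (i / d) → d ≤ i → ¬ Even ((i - d) / d) := by
    intro i hi hdi
    have h := even_add_div_iff hd (i - d)
    rw [Nat.sub_add_cancel hdi] at h
    tauto
  have h1' : ∀ i, i + d < q → firstInput q d a (i + d) + firstInput q d b i = 0 := by
    intro i hi
    simpa using h1 (i + d) hi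
  have h2' : ∀ i, i + d < q → secondInput q d a (i + d) + secondInput q d b i = 0 := by
    intro i hi
    simpa using h2 (i + d) hi
  have h2e : ∀ i < q, Even (i / d) → secondInput q d a i = 0 := by
    intro i hi he
    have h := h2 i hi
    split_ifs at h with hdi
    · rwa [secondInput.eq_def q d b, if_neg (hodd i he hdi), add_zero] at h
    · rwa [add_zero] at h
  -- Each symbol of `a` has an even level, in the first or second use, at which the shifted `b`
  -- comes from an odd level carrying zero.
  have haz : ∀ i, a i = 0 := by
    intro i
    rcases le_or_gt q i with hqi | hqi
    · exact ha i hqi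
    by_cases he : Even (i / d)
    · rcases lt_or_ge (i + d) q with hiq | hiq
      · have h := h1 i hqi
        rw [firstInput.eq_def q d a, if_pos he, if_pos hiq] at h
        split_ifs at h with hdi
        · rwa [firstInput.eq_def q d b, if_neg (hodd i he hdi), if_neg (by omega), add_zero] at h
        · rwa [add_zero] at h
      · have h := h2e i hqi he
        rwa [secondInput.eq_def, if_pos he, if_neg (by omega)] at h
    · obtain ⟨k, rfl, hk⟩ := heven i he
      have h := h2e k (by omega) hk
      rwa [secondInput.eq_def, if_pos hk, if_pos hqi] at h
  have hfa : ∀ i, firstInput q d a i = 0 := fun i => by simp [firstInput, haz]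
  have hsa : ∀ i, secondInput q d a i = 0 := fun i => by simp [secondInput, haz]
  refine ⟨haz, fun i hqi => ?_⟩
  by_cases he : Even (i / d)
  · rcases lt_or_ge (i + d) q with hiq | hiq
    · have h := h1' i hiq
      rwa [hfa, zero_add, firstInput.eq_def, if_pos he, if_pos hiq] at h
    -- The repeated copy is used here; `q ≤ i + d` and `2 * d ≤ q` give `d ≤ i`.
    · have h := h1' (i - d) (by omega)
      rwa [hfa, zero_add, firstInput.eq_def, if_neg (hodd i he (by omega)), if_pos (by omega),
        Nat.sub_add_cancel (by omega)] at h
  · obtain ⟨k, rfl, hk⟩ := heven i he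
    have h := h2' k hqi
    rwa [hsa, zero_add, secondInput.eq_def, if_pos hk, if_pos hqi] at h

/-- The two channel inputs `firstInput` and `secondInput` as a linear encoder. -/
def twoUseEncoder (q d : ℕ) : (Fin q → ZMod 2) →ₗ[ZMod 2] (Fin 2 → Fin q → ZMod 2) where
  toFun s t i :=
    if t = 0 then firstInput q d (extendZero q s) i else secondInput q d (extendZero q s) i
  map_add' s s' := by
    funext t i
    simp only [map_add, Pi.add_apply, firstInput, secondInput]
    split_ifs <;> simp
  map_smul' r s := by
    funext t i
    simp only [map_smul, Pi.smul_apply, firstInput, secondInput, RingHom.id_apply]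
    split_ifs <;> simp

theorem isLinearlyAchievable_half (hmn : m ≠ n) (h : max m n ≤ 2 * min m n) :
    IsLinearlyAchievable L m n (((max m n : ℕ) : ℝ) / 2) := by
  have key := isLinearlyAchievable_of_shift_injective (L := L) (K := max m n) (N := 2) hmn two_pos
    (twoUseEncoder (max m n) (max m n - min m n)) (fun a b hab => by
    obtain ⟨h1, h2⟩ := eq_zero_of_firstInput_of_secondInput (q := max m n)
      (d := max m n - min m n) (a := extendZero _ a) (b := extendZero _ b) (by omega) (by omega)
      (fun i hi => extendZero_of_le a hi)
      (fun i hi => by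
        have h1 := congrFun (hab 0) ⟨i, hi⟩
        rw [Pi.add_apply, shiftMatrix_pow_mulVec_apply] at h1
        simpa [twoUseEncoder] using h1)
      (fun i hi => by
        have h1 := congrFun (hab 1) ⟨i, hi⟩
        rw [Pi.add_apply, shiftMatrix_pow_mulVec_apply] at h1
        simpa [twoUseEncoder] using h1)
    exact ⟨eq_zero_of_extendZero fun i _ => h1 i, eq_zero_of_extendZero h2⟩)
  simpa using key

theorem linearComputingCapacity_eq (hL : 3 ≤ L) :
    linearComputingCapacity L m n =
      (((if m = n then (n : ℝ)
        else min (min (m : ℝ) (n : ℝ)) (max (m : ℝ) (n : ℝ) / 2)) : ℝ) : EReal) := by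
  apply le_antisymm
  · refine sSup_le ?_
    rintro _ ⟨R, ⟨K, N, c, hN, hl, hz, rfl⟩, rfl⟩
    have hN' : (0 : ℝ) < N := by exact_mod_cast hN
    rw [EReal.coe_le_coe_iff]
    have hn : (K : ℝ) / N ≤ n := by
      rw [div_le_iff₀ hN', mul_comm]
      have := hz.le_mul_linkLevels ⟨0, by omega⟩ ⟨0, by omega⟩
      rw [linkLevels, if_pos rfl] at this
      exact_mod_cast this
    split_ifs with hmn
    · exact hn
    · refine le_min (le_min ?_ hn) ?_
      · rw [div_le_iff₀ hN', mul_comm]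
        have := hz.le_mul_linkLevels ⟨1, by omega⟩ ⟨0, by omega⟩
        rw [linkLevels, if_neg (by simp [Fin.ext_iff])] at this
        exact_mod_cast this
      · have := two_mul_le_of_isLinear_of_isZeroError hl hz hL hmn
        have h2 : (2 : ℝ) * K ≤ N * max (m : ℝ) n := by exact_mod_cast this
        rw [div_le_div_iff₀ hN' two_pos]
        linarith
  · refine le_sSup ⟨_, ?_, rfl⟩
    rw [Set.mem_ofPred_eq]
    split_ifs with hmn
    · subst hmn
      exact isLinearlyAchievable_of_eq m
    -- The comparison decides which term is the minimum, and each regime has its own scheme.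
    · rcases le_total (2 * min m n) (max m n) with h | h
      · have h' : 2 * min (m : ℝ) n ≤ max (m : ℝ) n := by exact_mod_cast h
        rw [min_eq_left (by linarith)]
        exact_mod_cast isLinearlyAchievable_min hmn h
      · have h' : max (m : ℝ) n ≤ 2 * min (m : ℝ) n := by exact_mod_cast h
        rw [min_eq_right (by linarith)]
        exact_mod_cast isLinearlyAchievable_half hmn h

/-! ### Averaging and fibre counts -/

section Counting

variable {ι A : Type*} [Fintype ι] [DecidableEq ι] [Fintype A]

/-- Exchanging `x` with the coordinate `s i` is an involution of the pairs `(s, x)`. -/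
theorem sum_card_filter_update (i : ι) (P : (ι → A) → Prop) [DecidablePred P] :
    ∑ s : ι → A, (Finset.univ.filter fun x => P (Function.update s i x)).card =
      Fintype.card A * (Finset.univ.filter P).card := by
  have hinv : Function.Involutive
      (fun p : (ι → A) × A => ((Function.update p.1 i p.2, p.1 i) : (ι → A) × A)) := by
    rintro ⟨s, x⟩
    simp
  have h := Equiv.sum_comp hinv.toPerm fun p : (ι → A) × A => if P p.1 then 1 else 0
  rw [Fintype.sum_prod_type, Fintype.sum_prod_type] at h
  simp only [Finset.card_filter]
  calc _ = ∑ s : ι → A, ∑ _x : A, if P s then 1 else 0 := h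
    _ = _ := by simp only [Finset.sum_const, Finset.card_univ, smul_eq_mul, Finset.mul_sum]

theorem card_mul_card_filter_apply_mem [DecidableEq A] (i : ι) (S : Finset A) :
    Fintype.card A * (Finset.univ.filter fun s : ι → A => s i ∈ S).card =
      Fintype.card (ι → A) * S.card := by
  rw [← sum_card_filter_update i]
  simp

theorem card_mul_card_filter_sum_mem [DecidableEq A] [AddCommGroup A] (i : ι) (S : Finset A) :
    Fintype.card A * (Finset.univ.filter fun s : ι → A => ∑ j, s j ∈ S).card =
      Fintype.card (ι → A) * S.card := by
  rw [← sum_card_filter_update i]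
  have h : ∀ s : ι → A, (Finset.univ.filter fun x =>
      ∑ j, Function.update s i x j ∈ S).card = S.card := by
    intro s
    simp only [Finset.sum_update_of_mem (Finset.mem_univ i)]
    refine Finset.card_nbij' (fun x => x + ∑ j ∈ Finset.univ \ {i}, s j)
      (fun x => x - ∑ j ∈ Finset.univ \ {i}, s j) ?_ ?_ ?_ ?_ <;> intro x <;> simp
  simp [h]

theorem exists_card_mul_card_filter_update_le [Nonempty A] (i : ι) (P : (ι → A) → Prop)
    [DecidablePred P] :
    ∃ s : ι → A, Fintype.card (ι → A) *
      (Finset.univ.filter fun x => P (Function.update s i x)).card ≤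
        Fintype.card A * (Finset.univ.filter P).card := by
  obtain ⟨s, -, hs⟩ := Finset.exists_min_image (Finset.univ : Finset (ι → A))
    (fun s => (Finset.univ.filter fun x => P (Function.update s i x)).card)
    Finset.univ_nonempty
  refine ⟨s, ?_⟩
  rw [← sum_card_filter_update i, ← smul_eq_mul, ← Finset.card_univ]
  exact Finset.card_nsmul_le_sum _ _ _ hs

/-- Markov's inequality for the sizes of the fibres of a function. -/
theorem mul_card_filter_large_fiber_le {Y : Type*} [Fintype Y] [Nonempty Y] [DecidableEq A]
    (f : Y → A) (M : ℕ) :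
    M * (Finset.univ.filter fun t => M * Fintype.card Y <
      (Finset.univ.filter fun y => f y = t).card * Fintype.card A).card ≤ Fintype.card A := by
  set B := Finset.univ.filter fun t => M * Fintype.card Y <
      (Finset.univ.filter fun y => f y = t).card * Fintype.card A with hB
  have h1 : B.card * (M * Fintype.card Y) ≤
      ∑ t ∈ B, (Finset.univ.filter fun y => f y = t).card * Fintype.card A := by
    rw [← smul_eq_mul]
    exact Finset.card_nsmul_le_sum _ _ _ fun t ht => (Finset.mem_filter.1 ht).2.le
  have h2 : ∑ t ∈ B, (Finset.univ.filter fun y => f y = t).card ≤ Fintype.card Y := by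
    rw [← Finset.card_univ, Finset.card_eq_sum_card_fiberwise (f := f) (t := Finset.univ)
      fun _ _ => Finset.mem_coe.2 (Finset.mem_univ _)]
    exact Finset.sum_le_sum_of_subset (Finset.subset_univ _)
  rw [← Finset.sum_mul] at h1
  have h3 := h1.trans (Nat.mul_le_mul_right _ h2)
  refine Nat.le_of_mul_le_mul_left ?_ (Fintype.card_pos : 0 < Fintype.card Y)
  calc _ = B.card * (M * Fintype.card Y) := by ring
    _ ≤ _ := h3

end Counting

/-! ### Counting bounds for codes with small error -/

/-- The number of source values for which receiver `ℓ` errs. -/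
def Code.errorCount (c : Code L m n K N) (ℓ : Fin L) : ℕ :=
  (Finset.univ.filter fun s : Fin L → Fin K → ZMod 2 => c.estimate s ℓ ≠ ∑ j, s j).card

/-- Some choice of the other sources leaves few values of source `i` for which
receiver `ℓ` errs. -/
theorem exists_mul_card_wrong_le (c : Code L m n K N) (i ℓ : Fin L) {r : ℕ}
    (he : r * c.errorCount ℓ ≤ Fintype.card (Fin L → Fin K → ZMod 2)) :
    ∃ s : Fin L → Fin K → ZMod 2, r * (Finset.univ.filter fun x =>
      c.estimate (Function.update s i x) ℓ ≠ ∑ j, Function.update s i x j).card ≤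
        Fintype.card (Fin K → ZMod 2) := by
  obtain ⟨s, hs⟩ := exists_card_mul_card_filter_update_le i
    fun s : Fin L → Fin K → ZMod 2 => c.estimate s ℓ ≠ ∑ j, s j
  refine ⟨s, Nat.le_of_mul_le_mul_left ?_
    (Fintype.card_pos : 0 < Fintype.card (Fin L → Fin K → ZMod 2))⟩
  rw [mul_left_comm, mul_comm (Fintype.card (Fin L → Fin K → ZMod 2))
    (Fintype.card (Fin K → ZMod 2))]
  calc _ ≤ r * (Fintype.card (Fin K → ZMod 2) * c.errorCount ℓ) := Nat.mul_le_mul_left _ hs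
    _ = Fintype.card (Fin K → ZMod 2) * (r * c.errorCount ℓ) := by ring
    _ ≤ _ := Nat.mul_le_mul_left _ he

/-- For a suitable choice of the other sources at least half of the values are decoded correctly;
the half costs the extra bit. -/
theorem le_mul_linkLevels_add_one (c : Code L m n K N) (i ℓ : Fin L)
    (he : 2 * c.errorCount ℓ ≤ Fintype.card (Fin L → Fin K → ZMod 2)) :
    K ≤ N * linkLevels m n i ℓ + 1 := by
  obtain ⟨s, hs⟩ := exists_mul_card_wrong_le c i ℓ he
  have h1 := card_correct_le c i ℓ s
  have h2 := Finset.card_filter_add_card_filter_not (s := (Finset.univ : Finset (Fin K → ZMod 2)))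
    fun x => c.estimate (Function.update s i x) ℓ = ∑ j, Function.update s i x j
  rw [Finset.card_univ] at h2
  simp only [ne_eq] at hs
  have h3 : Fintype.card (Fin K → ZMod 2) ≤ 2 ^ (N * linkLevels m n i ℓ + 1) := by
    rw [pow_succ]
    omega
  simp only [Fintype.card_fun, ZMod.card, Fintype.card_fin] at h3
  exact (Nat.pow_le_pow_iff_right (by norm_num)).1 h3

/-- The number of output tuples on which all decoders agree on a common value whose fibres are
not large. -/
theorem card_mul_pow_le_of_injOn {S T Y : Type*} [Fintype T] [DecidableEq T] [Fintype Y]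
    [DecidableEq Y] (G : Finset S) (out : S → Fin L → Y) (hout : Set.InjOn out G) (τ : S → T)
    (dec : Fin L → Y → T) (hdec : ∀ s ∈ G, ∀ ℓ, dec ℓ (out s ℓ) = τ s) {k B : ℕ}
    (hB : ∀ s ∈ G, ∀ ℓ, (Finset.univ.filter fun y => dec ℓ y = τ s).card * k ≤ B) :
    G.card * k ^ L ≤ Fintype.card T * B ^ L := by
  have hfib : ∀ t : T, (G.filter fun s => τ s = t).card * k ^ L ≤ B ^ L := by
    intro t
    rcases (G.filter fun s => τ s = t).eq_empty_or_nonempty with h | ⟨s₀, hs₀⟩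
    · simp [h]
    obtain ⟨hs₀G, rfl⟩ := Finset.mem_filter.1 hs₀
    have h1 : (G.filter fun s => τ s = τ s₀).card ≤
        (Fintype.piFinset fun ℓ => Finset.univ.filter fun y => dec ℓ y = τ s₀).card := by
      refine Finset.card_le_card_of_injOn out ?_
        (hout.mono (Finset.coe_subset.2 (Finset.filter_subset _ _)))
      intro s hs
      obtain ⟨hsG, hst⟩ := Finset.mem_filter.1 (Finset.mem_coe.1 hs)
      rw [Finset.mem_coe, Fintype.mem_piFinset]
      intro ℓ
      rw [Finset.mem_filter, hdec s hsG ℓ]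
      exact ⟨Finset.mem_univ _, hst⟩
    rw [Fintype.card_piFinset] at h1
    have hpow : ∀ x : ℕ, x ^ L = ∏ _ℓ : Fin L, x := fun x => by simp
    calc _ ≤ _ := Nat.mul_le_mul_right _ h1
      _ = ∏ ℓ : Fin L, (Finset.univ.filter fun y => dec ℓ y = τ s₀).card * k := by
        rw [hpow, Finset.prod_mul_distrib]
      _ ≤ ∏ _ℓ : Fin L, B := Finset.prod_le_prod' fun ℓ _ => hB s₀ hs₀G ℓ
      _ = B ^ L := (hpow B).symm
  rw [Finset.card_eq_sum_card_fiberwise (f := τ) (t := Finset.univ)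
    fun _ _ => Finset.mem_coe.2 (Finset.mem_univ _), Finset.sum_mul, ← smul_eq_mul,
    ← Finset.card_univ]
  exact Finset.sum_le_card_nsmul _ _ _ fun t _ => hfib t

theorem two_mul_card_le_of_bad {S : Type*} [Fintype S] [DecidableEq S] (hL : 0 < L)
    (bad : Fin L → Finset S) (h : ∀ ℓ, 2 * L * (bad ℓ).card ≤ Fintype.card S) :
    Fintype.card S ≤ 2 * (Finset.univ.filter fun s => ∀ ℓ, s ∉ bad ℓ).card := by
  have h1 : (Finset.univ.filter fun s => ¬ ∀ ℓ, s ∉ bad ℓ).card ≤ ∑ ℓ, (bad ℓ).card := by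
    refine (Finset.card_le_card ?_).trans Finset.card_biUnion_le
    intro s hs
    simpa using hs
  have h2 := Finset.card_filter_add_card_filter_not (s := (Finset.univ : Finset S))
    fun s => ∀ ℓ, s ∉ bad ℓ
  rw [Finset.card_univ] at h2
  have h3 : 2 * ∑ ℓ, (bad ℓ).card ≤ Fintype.card S := by
    refine Nat.le_of_mul_le_mul_left ?_ hL
    rw [← mul_assoc, mul_comm L 2, Finset.mul_sum]
    refine (Finset.sum_le_card_nsmul _ _ _ fun ℓ _ => h ℓ).trans ?_
    simp
  omega

theorem two_mul_mul_le_of_errorCount (c : Code L m n K N) (hL : 0 < L) (hmn : m ≠ n)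
    (he : ∀ ℓ, 8 * L * c.errorCount ℓ ≤ Fintype.card (Fin L → Fin K → ZMod 2)) :
    2 * K * L ≤ K + N * max m n * L + (1 + (L + 2) * L) := by
  classical
  -- The background `s₀ ℓ` is a virtual choice of the other sources: outside `W ℓ`, it shows that `D
  -- X_ℓ` determines source `ℓ`.
  choose s₀ hs₀ using fun ℓ => exists_mul_card_wrong_le c ℓ ℓ (he ℓ)
  set W : Fin L → Finset (Fin K → ZMod 2) := fun ℓ => Finset.univ.filter fun x =>
      c.estimate (Function.update (s₀ ℓ) ℓ x) ℓ ≠ ∑ j, Function.update (s₀ ℓ) ℓ x j with hW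
  -- At least `4L`, for Markov's inequality, and a power of two, so that the final estimate compares
  -- exponents.
  set M := 2 ^ (L + 2) with hM
  have hML : 4 * L ≤ M := by
    have := (Nat.lt_two_pow_self (n := L)).le
    rw [hM, pow_add]
    omega
  set B : Fin L → Finset (Fin K → ZMod 2) := fun ℓ => Finset.univ.filter fun t =>
      M * Fintype.card (Fin N → Fin (max m n) → ZMod 2) <
      (Finset.univ.filter fun y => c.dec ℓ y = t).card * Fintype.card (Fin K → ZMod 2) with hB
  have hBcard : ∀ ℓ, 4 * L * (B ℓ).card ≤ Fintype.card (Fin K → ZMod 2) := fun ℓ =>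
    (Nat.mul_le_mul_right _ hML).trans (mul_card_filter_large_fiber_le (c.dec ℓ) M)
  -- The three parts have density at most `1/(8L)`, `1/(8L)` and `1/(4L)`; over all receivers they
  -- fill at most half of the space.
  set bad : Fin L → Finset (Fin L → Fin K → ZMod 2) := fun ℓ =>
    (Finset.univ.filter fun s => c.estimate s ℓ ≠ ∑ j, s j) ∪
      ((Finset.univ.filter fun s => s ℓ ∈ W ℓ) ∪
        (Finset.univ.filter fun s => ∑ j, s j ∈ B ℓ)) with hbad
  have hTpos : 0 < Fintype.card (Fin K → ZMod 2) := Fintype.card_pos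
  have hbadcard : ∀ ℓ, 2 * L * (bad ℓ).card ≤ Fintype.card (Fin L → Fin K → ZMod 2) := by
    intro ℓ
    have h1 : 8 * L * (Finset.univ.filter fun s : Fin L → Fin K → ZMod 2 => s ℓ ∈ W ℓ).card ≤
        Fintype.card (Fin L → Fin K → ZMod 2) := by
      refine Nat.le_of_mul_le_mul_left ?_ hTpos
      calc _ = 8 * L * (Fintype.card (Fin K → ZMod 2) *
            (Finset.univ.filter fun s : Fin L → Fin K → ZMod 2 => s ℓ ∈ W ℓ).card) := by ring
        _ = Fintype.card (Fin L → Fin K → ZMod 2) * (8 * L * (W ℓ).card) := by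
          rw [card_mul_card_filter_apply_mem]; ring
        _ ≤ Fintype.card (Fin L → Fin K → ZMod 2) * Fintype.card (Fin K → ZMod 2) :=
          Nat.mul_le_mul_left _ (hs₀ ℓ)
        _ = _ := mul_comm _ _
    have h2 : 4 * L * (Finset.univ.filter fun s : Fin L → Fin K → ZMod 2 => ∑ j, s j ∈ B ℓ).card ≤
        Fintype.card (Fin L → Fin K → ZMod 2) := by
      refine Nat.le_of_mul_le_mul_left ?_ hTpos
      calc _ = 4 * L * (Fintype.card (Fin K → ZMod 2) *
            (Finset.univ.filter fun s : Fin L → Fin K → ZMod 2 => ∑ j, s j ∈ B ℓ).card) := by ring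
        _ = Fintype.card (Fin L → Fin K → ZMod 2) * (4 * L * (B ℓ).card) := by
          rw [card_mul_card_filter_sum_mem ℓ]; ring
        _ ≤ Fintype.card (Fin L → Fin K → ZMod 2) * Fintype.card (Fin K → ZMod 2) :=
          Nat.mul_le_mul_left _ (hBcard ℓ)
        _ = _ := mul_comm _ _
    have h3 : (bad ℓ).card ≤ c.errorCount ℓ +
        ((Finset.univ.filter fun s : Fin L → Fin K → ZMod 2 => s ℓ ∈ W ℓ).card +
          (Finset.univ.filter fun s : Fin L → Fin K → ZMod 2 => ∑ j, s j ∈ B ℓ).card) :=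
      (Finset.card_union_le _ _).trans
        (Nat.add_le_add_left (Finset.card_union_le _ _) _)
    have h0 := he ℓ
    have h4 := Nat.mul_le_mul_left (2 * L) h3
    rw [mul_add, mul_add] at h4
    rw [show 8 * L = 4 * (2 * L) by ring, mul_assoc] at h0 h1
    rw [show 4 * L = 2 * (2 * L) by ring, mul_assoc] at h2
    omega
  have hG := two_mul_card_le_of_bad hL bad hbadcard
  set G := Finset.univ.filter fun s : Fin L → Fin K → ZMod 2 => ∀ ℓ, s ∉ bad ℓ with hGdef
  have hGmem : ∀ s ∈ G, ∀ ℓ, c.estimate s ℓ = ∑ j, s j ∧ s ℓ ∉ W ℓ ∧ ∑ j, s j ∉ B ℓ := by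
    intro s hs ℓ
    have h := (Finset.mem_filter.1 hs).2 ℓ
    simp only [hbad, Finset.mem_union, Finset.mem_filter, Finset.mem_univ, true_and, not_or,
      not_not, ne_eq] at h
    exact h
  have hinj : Set.InjOn c.received G := by
    intro s hs s' hs' hss
    funext ℓ
    have h := (hGmem s hs ℓ).2.1
    have h' := (hGmem s' hs' ℓ).2.1
    simp only [hW, Finset.mem_filter, Finset.mem_univ, true_and, not_not, ne_eq] at h h'
    refine eq_of_correct_of_gain_eq c ℓ ℓ (s₀ ℓ) h h' fun t => ?_
    rw [linkLevels, if_pos rfl]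
    exact directGain_mulVec_eq_of_output_eq hmn (X := fun j => c.enc j (s j) t)
      (X' := fun j => c.enc j (s' j) t) (fun j => congrFun (congrFun hss j) t) ℓ
  have hcount := card_mul_pow_le_of_injOn G c.received hinj (fun s => ∑ j, s j) c.dec
    (fun s hs ℓ => (hGmem s hs ℓ).1) (k := Fintype.card (Fin K → ZMod 2))
    (B := M * Fintype.card (Fin N → Fin (max m n) → ZMod 2))
    (fun s hs ℓ => by
      have h := (hGmem s hs ℓ).2.2
      simp only [hB, Finset.mem_filter, Finset.mem_univ, true_and, not_lt] at h
      exact h)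
  have hT' : Fintype.card (Fin K → ZMod 2) = 2 ^ K := by simp [ZMod.card]
  have hY' : Fintype.card (Fin N → Fin (max m n) → ZMod 2) = 2 ^ (N * max m n) := by
    simp [ZMod.card, ← pow_mul, mul_comm]
  have hS' : Fintype.card (Fin L → Fin K → ZMod 2) = (2 ^ K) ^ L := by simp [ZMod.card]
  -- The summand 1 pays for halving the source space, and `(L + 2) * L` for the factor `M ^ L`.
  have hfin : (2 : ℕ) ^ (2 * K * L) ≤ 2 ^ (K + N * max m n * L + (1 + (L + 2) * L)) := by
    calc (2 : ℕ) ^ (2 * K * L)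
      _ = Fintype.card (Fin L → Fin K → ZMod 2) * Fintype.card (Fin K → ZMod 2) ^ L := by
          rw [hS', hT']; ring
      _ ≤ 2 * G.card * Fintype.card (Fin K → ZMod 2) ^ L := Nat.mul_le_mul_right _ hG
      _ = 2 * (G.card * Fintype.card (Fin K → ZMod 2) ^ L) := by ring
      _ ≤ 2 * (Fintype.card (Fin K → ZMod 2) *
          (M * Fintype.card (Fin N → Fin (max m n) → ZMod 2)) ^ L) :=
          Nat.mul_le_mul_left _ hcount
      _ = _ := by
        rw [hT', hY', hM]
        simp only [mul_pow, ← pow_mul, pow_add, pow_one]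
        ring
  exact (Nat.pow_le_pow_iff_right (by norm_num)).1 hfin

theorem mul_errorCount_le (c : Code L m n K N) {ℓ : Fin L} {r : ℕ} (hr : 0 < r)
    (h : c.errorProb ℓ < 1 / r) :
    r * c.errorCount ℓ ≤ Fintype.card (Fin L → Fin K → ZMod 2) := by
  have hr' : (0 : ℝ) < r := by exact_mod_cast hr
  have hc : (0 : ℝ) < Fintype.card (Fin L → Fin K → ZMod 2) := by
    exact_mod_cast Fintype.card_pos
  rw [Code.errorProb, div_lt_div_iff₀ hc hr', one_mul] at h
  rw [mul_comm]
  exact_mod_cast h.le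

/-! ### Passage to the limit -/

/-- A bound on the code sizes that is affine in the length bounds the achievable rates. -/
theorem IsAchievable.le_of_code_bound {R : ℝ} (hR : IsAchievable L m n R) {r : ℕ} (hr : 0 < r)
    {ρ C : ℝ} (h : ∀ (K N : ℕ) (c : Code L m n K N),
      (∀ ℓ, r * c.errorCount ℓ ≤ Fintype.card (Fin L → Fin K → ZMod 2)) → (K : ℝ) ≤ ρ * N + C) :
    R ≤ ρ := by
  obtain ⟨K, c, hK, hc⟩ := hR
  have hlim : Tendsto (fun N : ℕ => ρ + C / N) atTop (𝓝 ρ) := by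
    simpa using tendsto_const_nhds.add (tendsto_const_div_atTop_nhds_zero_nat C)
  refine le_of_tendsto_of_tendsto hK hlim ?_
  have hr' : (0 : ℝ) < 1 / r := by positivity
  have hev : ∀ᶠ N in atTop, ∀ ℓ, (c N).errorProb ℓ < 1 / r :=
    eventually_all.2 fun ℓ => (hc ℓ).eventually (gt_mem_nhds hr')
  filter_upwards [hev, eventually_gt_atTop 0] with N hN hpos
  have hpos' : (0 : ℝ) < N := by exact_mod_cast hpos
  have hb := h (K N) N (c N) fun ℓ => mul_errorCount_le _ hr (hN ℓ)
  rw [div_le_iff₀ hpos', add_mul, div_mul_cancel₀ _ hpos'.ne']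
  exact hb

theorem IsAchievable.le_linkLevels {R : ℝ} (hR : IsAchievable L m n R) (i ℓ : Fin L) :
    R ≤ linkLevels m n i ℓ :=
  hR.le_of_code_bound two_pos (C := 1) fun K N c hc => by
    have := le_mul_linkLevels_add_one c i ℓ (hc ℓ)
    rw [mul_comm]
    exact_mod_cast this

theorem IsAchievable.le_mul_max {R : ℝ} (hR : IsAchievable L m n R) (hL : 0 < L) (hmn : m ≠ n) :
    R ≤ (L : ℝ) / (2 * (L : ℝ) - 1) * max (m : ℝ) (n : ℝ) := by
  have hL1 : (1 : ℝ) ≤ L := by exact_mod_cast hL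
  have hpos : (0 : ℝ) < 2 * L - 1 := by linarith
  refine hR.le_of_code_bound (r := 8 * L) (by omega)
    (C := (1 + (L + 2) * L) / (2 * L - 1)) fun K N c hc => ?_
  have h := two_mul_mul_le_of_errorCount c hL hmn hc
  have h' : (2 : ℝ) * K * L ≤ K + N * max (m : ℝ) n * L + (1 + (L + 2) * L) := by
    exact_mod_cast h
  have heq : (L : ℝ) / (2 * L - 1) * max (m : ℝ) n * N + (1 + (L + 2) * L) / (2 * L - 1) =
      (N * max (m : ℝ) n * L + (1 + (L + 2) * L)) / (2 * L - 1) := by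
    field_simp
  rw [heq, le_div_iff₀ hpos]
  linarith

theorem computingCapacity_le (hL : 3 ≤ L) :
    computingCapacity L m n ≤
      (((if m = n then (n : ℝ)
        else min (min (m : ℝ) (n : ℝ))
          ((L : ℝ) / (2 * (L : ℝ) - 1) * max (m : ℝ) (n : ℝ))) : ℝ) : EReal) := by
  refine sSup_le ?_
  rintro _ ⟨R, hR, rfl⟩
  rw [Set.mem_ofPred_eq] at hR
  rw [EReal.coe_le_coe_iff]
  have hn : R ≤ n := by
    simpa [linkLevels] using hR.le_linkLevels ⟨0, by omega⟩ ⟨0, by omega⟩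
  split_ifs with hmn
  · exact hn
  · refine le_min (le_min ?_ hn) (hR.le_mul_max (by omega) hmn)
    simpa [linkLevels, Fin.ext_iff] using hR.le_linkLevels ⟨1, by omega⟩ ⟨0, by omega⟩

end ADT

theorem theorem5 (L m n : ℕ) (hL : 3 ≤ L) :
    ADT.linearComputingCapacity L m n =
        (((if m = n then (n : ℝ)
          else min (min (m : ℝ) (n : ℝ)) (max (m : ℝ) (n : ℝ) / 2)) : ℝ) : EReal) ∧
      ADT.computingCapacity L m n ≤
        (((if m = n then (n : ℝ)
          else min (min (m : ℝ) (n : ℝ))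
            ((L : ℝ) / (2 * (L : ℝ) - 1) * max (m : ℝ) (n : ℝ))) : ℝ) : EReal) :=
  ⟨ADT.linearComputingCapacity_eq hL, ADT.computingCapacity_le hL⟩
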